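/- Let $n,m\ge 0$ be integers, let $K\subset\mathbb{R}^n$ be compact, and let $\sigma\in C^1(\mathbb{R})$ be a function that is not a polynomial, applied coordinatewise to vectors. Write $\|v\|_\infty=\max_i|v_i|$ and $\|v\|_2=(\sum_i v_i^2)^{1/2}$. (a) Let $f:K\to\mathbb{R}^m$ satisfy $\|f(x)-f(y)\|_\infty\le L\|x-y\|_\infty$ for all $x,y\in K$. Then for every $\epsilon>0$ there exist $k\in\mathbb{N}$, $A\in\mathbb{R}^{k\times n}$, $b\in\mathbb{R}^k$ and $C\in\mathbb{R}^{m\times k}$ such that the neural network $\phi(x)=C\,\sigma(Ax+b)$ satisfies $\sup_{x\in K}\|f(x)-\phi(x)\|_2<\epsilon$ and $$\|\phi(x)-\phi(y)\|_\infty\le (L+\epsilon)\,\|x-y\|_\infty\qquad\text{for all }x,y\in K.$$ (b) Let $f:K\to\mathbb{R}^m$ satisfy $\|f(x)-f(y)\|_\infty\le L\|x-y\|_2$ for all $x,y\in K$. Then for every $\epsilon>0$ there exist $k\in\mathbb{N}$, $A\in\mathbb{R}^{k\times n}$, $b\in\mathbb{R}^k$ and $C\in\mathbb{R}^{m\times k}$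 such that the neural network $\phi(x)=C\,\sigma(Ax+b)$ satisfies $\sup_{x\in K}\|f(x)-\phi(x)\|_2<\epsilon$ and $$\|\phi(x)-\phi(y)\|_\infty\le \Bigl(L+\epsilon\Bigl(\tfrac{\sqrt{n+n/\epsilon}}{2}+L\Bigr)\Bigr)\|x-y\|_2\qquad\text{for all }x,y\in K.$$ -/

import Mathlib

/-- The one-hidden-layer network `φ(x) = C (σ ∘ (A x + b))` from `ℝⁿ` to `ℝᵐ` with `k` hidden
units; the activation `σ` is applied to each coordinate of `A x + b`. -/
def shallowNet {n m k : ℕ} (σ : ℝ → ℝ) (A : Matrix (Fin k) (Fin n) ℝ) (b : Fin k → ℝ)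
    (C : Matrix (Fin m) (Fin k) ℝ) (x : Fin n → ℝ) : Fin m → ℝ :=
  C.mulVec (σ ∘ (A.mulVec x + b))

/-- The uniform (maximum) norm on `ℝᵈ`, which is Mathlib's norm on `Fin d → ℝ`. -/
noncomputable def normInf {d : ℕ} (v : Fin d → ℝ) : ℝ := ‖v‖

/-- The Euclidean norm (two norm) on `ℝᵈ`. -/
noncomputable def normTwo {d : ℕ} (v : Fin d → ℝ) : ℝ := ‖WithLp.toLp 2 v‖

/-- `L` is a Lipschitz constant of `g : K → ℝᵐ`, where `ℝᵐ` carries the uniform norm and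
`K ⊆ ℝⁿ` carries the metric that comes from the norm `N` of `ℝⁿ`. -/
def HasLipConst {n m : ℕ} (N : (Fin n → ℝ) → ℝ) {K : Set (Fin n → ℝ)} (g : K → Fin m → ℝ)
    (L : ℝ) : Prop :=
  ∀ x y : K, normInf (g x - g y) ≤ L * N (x.1 - y.1)

/-- `sup_{x ∈ K} |f x - g x| < ε` with the Euclidean norm `|·|` of `ℝᵐ`. The first conjunct says
that the supremum is finite. -/
def UnifClose {n m : ℕ} {K : Set (Fin n → ℝ)} (f g : K → Fin m → ℝ) (ε : ℝ) : Prop :=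
  BddAbove (Set.range fun x : K => normTwo (f x - g x)) ∧
    (⨆ x : K, normTwo (f x - g x)) < ε

/-! Any constant strictly above `L` can be reached, for the norm of any finite-dimensional space.
Each coordinate of `f` is extended to an `L`-Lipschitz function `F` on the whole space and convolved
with a Lipschitz bump `k` of small support: `k * F` is still `L`-Lipschitz and close to `F`.
Stone–Weierstrass gives a sum `g` of exponentials of linear functionals uniformly close to `F`. Then
`k * g` is again such a sum (`exists_mem_expSpan_mollify`), and `k * (g - F)` has a small Lipschitz
constant, because the kernel carries the dependence on the point (`lipClose_mollify`).

It remains to replace `exp` on an interval by combinations of `σ (a t + b)` with control of the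
derivative (`exists_mem_span_approx_exp`). This follows from the uniform density of the functions
`σ' (a t + b)`, as `σ'` is continuous and not a polynomial. For smooth `τ`, differentiating `τ (a t
+ b)` in `a` and setting `a = 0` would produce the monomials. For continuous `τ`, iterated moving
averages supply the derivatives, with forward differences of `τ` in their place; by Fréchet's
theorem these do not all vanish. -/

/-! ### Uniform density of dilates and translates of a continuous non-polynomial function -/

section UniformDensity

/-- A function all of whose `k`-th forward differences vanish agrees with a polynomial on every
lattice ray. -/
theorem exists_polynomial_of_fwdDiff_iter_eq_zero {τ : ℝ → ℝ} {k : ℕ} {h : ℝ}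
    (hτ : ∀ y, (fwdDiff h)^[k] τ y = 0) (y : ℝ) :
    ∃ p : Polynomial ℝ, ∀ n : ℕ, τ (y + n * h) = p.eval (n : ℝ) := by
  have hz : ∀ j, k ≤ j → ∀ y, (fwdDiff h)^[j] τ y = 0 := by
    intro j hj
    induction j, hj using Nat.le_induction with
    | base => exact hτ
    | succ j _ ih =>
      intro y
      rw [Function.iterate_succ_apply', fwdDiff, ih, ih, sub_zero]
  -- Newton's forward difference series, cut off at order `k`.
  refine ⟨∑ j ∈ Finset.range k, Polynomial.C ((fwdDiff h)^[j] τ y * ((j.factorial : ℝ)⁻¹)) *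
    descPochhammer ℝ j, fun n => ?_⟩
  have key := shift_eq_sum_fwdDiff_iter (h := h) τ n y
  rw [nsmul_eq_mul] at key
  rw [key, Polynomial.eval_finsetSum]
  have h1 : ∀ j, (Polynomial.C ((fwdDiff h)^[j] τ y * ((j.factorial : ℝ)⁻¹)) *
      descPochhammer ℝ j).eval (n : ℝ) = n.choose j • (fwdDiff h)^[j] τ y := by
    intro j
    rw [Polynomial.eval_mul, Polynomial.eval_C, nsmul_eq_mul, Nat.cast_choose_eq_descPochhammer_div]
    ring
  simp only [h1]
  rcases le_total k (n + 1) with hk | hk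
  · refine (Finset.sum_subset (Finset.range_mono hk) fun j _ hj => ?_).symm
    rw [hz j (by simpa using hj), smul_zero]
  · refine Finset.sum_subset (Finset.range_mono hk) fun j _ hj => ?_
    rw [Nat.choose_eq_zero_of_lt (by simpa using hj), zero_smul]

/-- Two polynomials that agree at all natural numbers are equal. -/
theorem Polynomial.eq_of_eval_natCast_eq {p q : Polynomial ℝ}
    (h : ∀ n : ℕ, p.eval (n : ℝ) = q.eval (n : ℝ)) : p = q :=
  Polynomial.eq_of_infinite_eval_eq p q <|
    (Set.infinite_range_of_injective (Nat.cast_injective (R := ℝ))).mono <| by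
      rintro _ ⟨n, rfl⟩; exact h n

/-- A continuous function whose `k`-th forward differences vanish for all steps is a polynomial on
every closed half-line. -/
theorem exists_polynomial_on_Ici_of_fwdDiff_iter_eq_zero {τ : ℝ → ℝ} (hc : Continuous τ) {k : ℕ}
    (hτ : ∀ h y, (fwdDiff h)^[k] τ y = 0) (y : ℝ) :
    ∃ p : Polynomial ℝ, ∀ t, 0 ≤ t → τ (y + t) = p.eval t := by
  obtain ⟨p, hp⟩ := exists_polynomial_of_fwdDiff_iter_eq_zero (hτ 1) y
  refine ⟨p, ?_⟩
  have hrat : ∀ (N a : ℕ), τ (y + (a : ℝ) / (N + 1)) = p.eval ((a : ℝ) / (N + 1)) := by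
    intro N a
    obtain ⟨q, hq⟩ := exists_polynomial_of_fwdDiff_iter_eq_zero (hτ (1 / ((N : ℝ) + 1))) y
    have hN : (N : ℝ) + 1 ≠ 0 := by positivity
    -- The polynomial found for the finer step `1 / (N + 1)` agrees with `p` at the integers after
    -- rescaling, so one `p` serves all rational points.
    have hpq : q.comp (Polynomial.C ((N : ℝ) + 1) * Polynomial.X) = p := by
      refine Polynomial.eq_of_eval_natCast_eq fun n => ?_
      rw [← hp n]
      have := hq ((N + 1) * n)
      push_cast at this
      rw [Polynomial.eval_comp, Polynomial.eval_mul, Polynomial.eval_C, Polynomial.eval_X, ← this]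
      congr 1
      field_simp
    rw [← hpq, Polynomial.eval_comp, Polynomial.eval_mul, Polynomial.eval_C, Polynomial.eval_X,
      mul_div_cancel₀ _ hN, ← hq a, mul_one_div]
  intro t ht
  have h1 : Filter.Tendsto (fun n : ℕ => ((⌊t * ((n : ℝ) + 1)⌋₊ : ℝ) / ((n : ℝ) + 1)))
      Filter.atTop (nhds t) :=
    (tendsto_nat_floor_mul_div_atTop ht).comp
      (Filter.tendsto_atTop_add_const_right _ _ tendsto_natCast_atTop_atTop)
  have h2 := ((hc.comp (continuous_const_add y)).tendsto t).comp h1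
  have h3 := (p.continuous.tendsto t).comp h1
  refine tendsto_nhds_unique h2 (h3.congr fun n => ?_)
  exact (hrat n _).symm

/-- Fréchet's characterization of polynomials: a continuous function all of whose `k`-th forward
differences vanish is a polynomial. -/
theorem exists_polynomial_of_continuous_of_fwdDiff_iter_eq_zero {τ : ℝ → ℝ} (hc : Continuous τ)
    {k : ℕ} (hτ : ∀ h y, (fwdDiff h)^[k] τ y = 0) :
    ∃ p : Polynomial ℝ, ∀ t, τ t = p.eval t := by
  obtain ⟨p, hp⟩ := exists_polynomial_on_Ici_of_fwdDiff_iter_eq_zero hc hτ 0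
  refine ⟨p, fun t => ?_⟩
  -- The half-line from `-|t|` contains both `t` and `[0, ∞)`, where `p` is already known.
  obtain ⟨q, hq⟩ := exists_polynomial_on_Ici_of_fwdDiff_iter_eq_zero hc hτ (-|t|)
  have hpq : q.comp (Polynomial.X + Polynomial.C |t|) = p := by
    refine Polynomial.eq_of_eval_natCast_eq fun n => ?_
    have h1 := hp n n.cast_nonneg
    have h2 := hq (n + |t|) (by positivity)
    rw [Polynomial.eval_comp, Polynomial.eval_add, Polynomial.eval_C, Polynomial.eval_X, ← h1, ← h2]
    congr 1; ring
  have h2 := hq (t + |t|) (by linarith [neg_abs_le t])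
  rw [← hpq, Polynomial.eval_comp, Polynomial.eval_add, Polynomial.eval_C, Polynomial.eval_X, ← h2]
  congr 1; ring

/-- Iterated forward differences commute with differentiation. -/
theorem hasDerivAt_fwdDiff_iter {f f' : ℝ → ℝ} (hf : ∀ x, HasDerivAt f (f' x) x) (h : ℝ) (k : ℕ)
    (x : ℝ) : HasDerivAt ((fwdDiff h)^[k] f) ((fwdDiff h)^[k] f' x) x := by
  induction k generalizing f f' with
  | zero => exact hf x
  | succ k ih =>
    rw [Function.iterate_succ_apply, Function.iterate_succ_apply]
    exact ih fun y => ((hf (y + h)).comp_add_const y h).sub (hf y)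

theorem continuous_fwdDiff_iter {f : ℝ → ℝ} (hf : Continuous f) (h : ℝ) (k : ℕ) :
    Continuous ((fwdDiff h)^[k] f) := by
  induction k generalizing f with
  | zero => exact hf
  | succ k ih =>
    rw [Function.iterate_succ_apply]
    exact ih (((hf.comp (continuous_add_const h))).sub hf)

/-- The integral of a continuous curve in a closed subspace lies in the subspace. -/
theorem Submodule.intervalIntegral_mem_of_isClosed {F : Type*} [NormedAddCommGroup F]
    [NormedSpace ℝ F] [CompleteSpace F] {G : Submodule ℝ F} (hG : IsClosed (G : Set F))
    {γ : ℝ → F} (hγ : Continuous γ) (hmem : ∀ t, γ t ∈ G) (a b : ℝ) : ∫ t in a..b, γ t ∈ G := by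
  -- Since `G` is complete, the integral can be formed inside `G` and pushed through the inclusion.
  have := hG.completeSpace_coe
  have hγ' : Continuous fun t => (⟨γ t, hmem t⟩ : G) := hγ.subtype_mk hmem
  have := G.subtypeL.intervalIntegral_comp_comm (hγ'.intervalIntegrable (μ := MeasureTheory.volume) a b)
  simp only [Submodule.subtypeL_apply] at this
  rw [this]
  exact Subtype.mem _

/-- The derivative of a curve in a closed subspace lies in the subspace. -/
theorem Submodule.mem_of_hasDerivAt_of_isClosed {F : Type*} [NormedAddCommGroup F]
    [NormedSpace ℝ F] {G : Submodule ℝ F} (hG : IsClosed (G : Set F))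
    {γ : ℝ → F} (hmem : ∀ t, γ t ∈ G) {v : F} {a : ℝ} (h : HasDerivAt γ v a) : v ∈ G := by
  have h1 := range_deriv_subset_closure_span_image γ dense_univ ⟨a, h.deriv⟩
  refine hG.closure_subset_iff.2 ?_ h1
  refine Submodule.span_le.2 ?_
  rintro _ ⟨t, -, rfl⟩
  exact hmem t

variable {X : Type*} [TopologicalSpace X]

/-- The function `x ↦ τ (a * s x + b)` as a continuous map. -/
def affineComp (τ : C(ℝ, ℝ)) (s : C(X, ℝ)) (a b : ℝ) : C(X, ℝ) :=
  ⟨fun x => τ (a * s x + b), by fun_prop⟩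

@[simp] theorem affineComp_apply (τ : C(ℝ, ℝ)) (s : C(X, ℝ)) (a b : ℝ) (x : X) :
    affineComp τ s a b x = τ (a * s x + b) := rfl

variable [CompactSpace X]

/-- A curve of continuous functions is differentiable if it is so pointwise, with jointly
continuous derivative. -/
theorem ContinuousMap.hasDerivAt_of_pointwise {γ : ℝ → C(X, ℝ)} {γ' : ℝ → C(X, ℝ)}
    (hc : Continuous γ') (h : ∀ a x, HasDerivAt (fun r => γ r x) (γ' a x) a) (a : ℝ) :
    HasDerivAt γ (γ' a) a := by
  have h1 : γ = fun r => γ 0 + ∫ t in (0 : ℝ)..r, γ' t := by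
    funext r
    ext x
    have := (ContinuousMap.evalCLM ℝ x).intervalIntegral_comp_comm
      (hc.intervalIntegrable (μ := MeasureTheory.volume) 0 r)
    simp only [ContinuousMap.evalCLM_apply] at this
    rw [ContinuousMap.add_apply, ← this, intervalIntegral.integral_eq_sub_of_hasDerivAt
      (fun t _ => h t x) (((ContinuousMap.evalCLM ℝ x).continuous.comp hc).intervalIntegrable _ _)]
    ring
  rw [h1]
  exact ((intervalIntegral.integral_hasDerivAt_right (hc.intervalIntegrable _ _)
    (hc.stronglyMeasurableAtFilter _ _) hc.continuousAt).const_add _)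

theorem continuous_pow_mul_affineComp (τ : C(ℝ, ℝ)) (s : C(X, ℝ)) (k : ℕ) :
    Continuous fun p : ℝ × ℝ => s ^ k * affineComp τ s p.1 p.2 := by
  refine continuous_const.mul ?_
  exact ContinuousMap.continuous_of_continuous_uncurry _ (by
    simp only [Function.uncurry_def, affineComp_apply]; fun_prop)

/-- Moving averages of `τ` over intervals of length `h`, up to normalization. -/
noncomputable def boxIntegral (h : ℝ) (τ : C(ℝ, ℝ)) : C(ℝ, ℝ) :=
  ⟨fun x => ∫ t in (0 : ℝ)..h, τ (x + t),
    intervalIntegral.continuous_parametric_intervalIntegral_of_continuous' (by fun_prop) 0 h⟩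

/-- Each moving average gains one derivative, and that derivative is a forward difference of the
original function; no smoothness of `τ` is needed. -/
theorem hasDerivAt_boxIntegral (h : ℝ) (τ : C(ℝ, ℝ)) (x : ℝ) :
    HasDerivAt (boxIntegral h τ) (fwdDiff h τ x) x := by
  have h1 : (boxIntegral h τ : ℝ → ℝ) =
      fun x => (∫ t in (0 : ℝ)..(x + h), τ t) - ∫ t in (0 : ℝ)..x, τ t := by
    funext x
    change ∫ t in (0 : ℝ)..h, τ (x + t) = _
    rw [intervalIntegral.integral_comp_add_left (fun t => τ t) x, add_zero,
      intervalIntegral.integral_interval_sub_left (τ.continuous.intervalIntegrable _ _)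
        (τ.continuous.intervalIntegrable _ _)]
  have h2 : ∀ y, HasDerivAt (fun x => ∫ t in (0 : ℝ)..x, τ t) (τ y) y := fun y =>
    intervalIntegral.integral_hasDerivAt_right (τ.continuous.intervalIntegrable _ _)
      (τ.continuous.stronglyMeasurableAtFilter _ _) τ.continuous.continuousAt
  rw [h1]
  exact ((h2 (x + h)).comp_add_const x h).sub (h2 x)

theorem affineComp_boxIntegral_mem {G : Submodule ℝ C(X, ℝ)} (hG : IsClosed (G : Set C(X, ℝ)))
    {s : C(X, ℝ)} {τ : C(ℝ, ℝ)} (hτ : ∀ a b, affineComp τ s a b ∈ G) (h a b : ℝ) :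
    affineComp (boxIntegral h τ) s a b ∈ G := by
  have hc : Continuous fun t => affineComp τ s a (b + t) := by
    have := (continuous_pow_mul_affineComp τ s 0).comp
      (continuous_const.prodMk (continuous_const.add continuous_id) : Continuous fun t => (a, b + t))
    simpa [Function.comp_def] using this
  have h1 : affineComp (boxIntegral h τ) s a b = ∫ t in (0 : ℝ)..h, affineComp τ s a (b + t) := by
    ext x
    have := (ContinuousMap.evalCLM ℝ x).intervalIntegral_comp_comm
      (hc.intervalIntegrable (μ := MeasureTheory.volume) 0 h)
    simp only [ContinuousMap.evalCLM_apply, affineComp_apply] at this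
    rw [← this]
    simp only [affineComp_apply, boxIntegral, ContinuousMap.coe_mk, add_assoc]
  rw [h1]
  exact G.intervalIntegral_mem_of_isClosed hG hc (fun t => hτ a (b + t)) 0 h

/-- Induction on `k`, applied to the moving average of `τ`, whose dilates and translates also lie in
`G`. Differentiating in `a` brings out a factor `s` and turns the average into one more difference
of `τ`; a closed subspace keeps such derivatives. -/
theorem pow_mul_affineComp_fwdDiff_mem {G : Submodule ℝ C(X, ℝ)}
    (hG : IsClosed (G : Set C(X, ℝ))) {s : C(X, ℝ)} (h : ℝ) (k : ℕ) {τ : C(ℝ, ℝ)}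
    (hτ : ∀ a b, affineComp τ s a b ∈ G) (a b : ℝ) :
    s ^ k * affineComp ⟨_, continuous_fwdDiff_iter τ.continuous h k⟩ s a b ∈ G := by
  induction k generalizing τ a b with
  | zero =>
    rw [pow_zero, one_mul]
    exact hτ a b
  | succ k ih =>
    have hd : ∀ x, HasDerivAt ((fwdDiff h)^[k] (boxIntegral h τ)) ((fwdDiff h)^[k + 1] τ x) x := by
      intro x
      rw [Function.iterate_succ_apply]
      exact hasDerivAt_fwdDiff_iter (hasDerivAt_boxIntegral h τ) h k x
    refine G.mem_of_hasDerivAt_of_isClosed hG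
      (fun r => ih (affineComp_boxIntegral_mem hG hτ h) r b) (a := a) ?_
    refine ContinuousMap.hasDerivAt_of_pointwise
      (γ' := fun a => s ^ (k + 1) * affineComp ⟨_, continuous_fwdDiff_iter τ.continuous h (k + 1)⟩ s a b)
      ((continuous_pow_mul_affineComp _ s (k + 1)).comp (continuous_id.prodMk continuous_const))
      (fun r x => ?_) a
    have h1 : HasDerivAt (fun r => r * s x + b) (s x) r := by
      simpa using ((hasDerivAt_id r).mul_const (s x)).add_const b
    have h2 := ((hd (r * s x + b)).comp r h1).const_mul (s x ^ k)
    refine h2.congr_deriv ?_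
    simp only [ContinuousMap.mul_apply, ContinuousMap.pow_apply, affineComp_apply,
      ContinuousMap.coe_mk]
    ring

/-- Uniform density of the dilates and translates of a non-polynomial function. -/
theorem topologicalClosure_span_affineComp_eq_top {τ : C(ℝ, ℝ)}
    (hτ : ¬ ∃ p : Polynomial ℝ, ∀ t : ℝ, τ t = p.eval t) (R : ℝ) :
    (Submodule.span ℝ {g : C(Set.Icc (-R) R, ℝ) | ∃ a b : ℝ, a ≠ 0 ∧
      g = affineComp τ ⟨Subtype.val, continuous_subtype_val⟩ a b}).topologicalClosure = ⊤ := by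
  set s : C(Set.Icc (-R) R, ℝ) := ⟨Subtype.val, continuous_subtype_val⟩ with hs
  set G := (Submodule.span ℝ {g : C(Set.Icc (-R) R, ℝ) | ∃ a b : ℝ, a ≠ 0 ∧
      g = affineComp τ s a b}).topologicalClosure with hGdef
  have hG : IsClosed (G : Set C(Set.Icc (-R) R, ℝ)) := Submodule.isClosed_topologicalClosure _
  have h0 : ∀ a b, a ≠ 0 → affineComp τ s a b ∈ G := fun a b ha =>
    Submodule.le_topologicalClosure _ (Submodule.subset_span ⟨a, b, ha, rfl⟩)
  have h1 : ∀ a b, affineComp τ s a b ∈ G := by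
    intro a b
    have hc : Continuous fun r => affineComp τ s r b := by
      have := (continuous_pow_mul_affineComp τ s 0).comp
        (continuous_id.prodMk continuous_const : Continuous fun r : ℝ => (r, b))
      simpa [Function.comp_def] using this
    -- The generators exclude `a = 0` so that primitives can later be formed by dividing by `a`;
    -- continuity in `a` restores it here.
    have hcl : closure {(0 : ℝ)}ᶜ ⊆ (fun r => affineComp τ s r b) ⁻¹' (G : Set _) :=
      closure_minimal (fun r hr => h0 r b hr) (hG.preimage hc)
    rw [closure_compl_singleton] at hcl
    exact hcl (Set.mem_univ a)
  have h2 : ∀ k : ℕ, s ^ k ∈ G := by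
    intro k
    have : ∃ h y, (fwdDiff h)^[k] τ y ≠ 0 := by
      by_contra! hcon
      exact hτ (exists_polynomial_of_continuous_of_fwdDiff_iter_eq_zero τ.continuous hcon)
    obtain ⟨h, y, hy⟩ := this
    -- At `a = 0` the second factor is the nonzero constant `(fwdDiff h)^[k] τ y`, which leaves the
    -- monomial `s ^ k`.
    have h3 := G.smul_mem ((fwdDiff h)^[k] τ y)⁻¹ (pow_mul_affineComp_fwdDiff_mem hG h k h1 0 y)
    convert h3 using 1
    ext x
    simp only [ContinuousMap.pow_apply, ContinuousMap.smul_apply, ContinuousMap.mul_apply,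
      affineComp_apply, ContinuousMap.coe_mk, smul_eq_mul, zero_mul, zero_add]
    field_simp
  have h3 : (polynomialFunctions (Set.Icc (-R) R) : Set C(Set.Icc (-R) R, ℝ)) ⊆ G := by
    rintro _ ⟨p, -, rfl⟩
    have : (Polynomial.toContinuousMapOnAlgHom (Set.Icc (-R) R)) p =
        ∑ i ∈ Finset.range (p.natDegree + 1), p.coeff i • s ^ i := by
      ext x
      simp [Polynomial.eval_eq_sum_range, ContinuousMap.sum_apply, hs]
    change (Polynomial.toContinuousMapOnAlgHom (Set.Icc (-R) R)) p ∈ G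
    rw [this]
    exact G.sum_mem fun i _ => G.smul_mem _ (h2 i)
  have h4 := hG.closure_subset_iff.2 h3
  have h5 : closure (polynomialFunctions (Set.Icc (-R) R) : Set C(Set.Icc (-R) R, ℝ)) = Set.univ := by
    rw [← Subalgebra.topologicalClosure_coe, polynomialFunctions_closure_eq_top, Algebra.coe_top]
  rw [h5] at h4
  exact top_unique fun g _ => h4 (Set.mem_univ g)

end UniformDensity

/-! ### Approximation of the exponential together with its derivative -/

section DerivativeDensity

theorem Polynomial.exists_derivative_eq (p : Polynomial ℝ) :
    ∃ q : Polynomial ℝ, q.derivative = p := by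
  refine ⟨∑ i ∈ Finset.range (p.natDegree + 1),
    Polynomial.C (p.coeff i / (i + 1)) * Polynomial.X ^ (i + 1), ?_⟩
  conv_rhs => rw [p.as_sum_range_C_mul_X_pow]
  rw [Polynomial.derivative_sum]
  refine Finset.sum_congr rfl fun i _ => ?_
  rw [Polynomial.derivative_C_mul_X_pow, Nat.add_sub_cancel]
  congr 2
  push_cast
  field_simp

theorem not_exists_polynomial_deriv {σ : ℝ → ℝ} (hσ : Differentiable ℝ σ)
    (hp : ¬ ∃ p : Polynomial ℝ, ∀ t : ℝ, σ t = p.eval t) :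
    ¬ ∃ p : Polynomial ℝ, ∀ t : ℝ, deriv σ t = p.eval t := by
  rintro ⟨p, h⟩
  obtain ⟨q, rfl⟩ := p.exists_derivative_eq
  refine hp ⟨q + Polynomial.C (σ 0 - q.eval 0), fun t => ?_⟩
  have h1 := is_const_of_deriv_eq_zero (f := fun t => σ t - q.eval t)
    (hσ.sub q.differentiable) (fun x => by
      rw [deriv_fun_sub (hσ x) q.differentiableAt, h x, Polynomial.deriv, sub_self]) t 0
  rw [Polynomial.eval_add, Polynomial.eval_C]
  linarith

/-- The span of the dilates and translates of a non-polynomial `C¹` function approximates the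
exponential function in the `C¹` sense on bounded intervals. -/
theorem exists_mem_span_approx_exp {σ : ℝ → ℝ} (hσ : ContDiff ℝ 1 σ)
    (hp : ¬ ∃ p : Polynomial ℝ, ∀ t : ℝ, σ t = p.eval t) {R δ : ℝ} (hR : 0 ≤ R) (hδ : 0 < δ) :
    ∃ u ∈ Submodule.span ℝ (Set.range fun q : ℝ × ℝ => fun t : ℝ => σ (q.1 * t + q.2)),
      (∀ t ∈ Set.Icc (-R) R, |u t - Real.exp t| ≤ δ) ∧
      ∀ s ∈ Set.Icc (-R) R, ∀ t ∈ Set.Icc (-R) R,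
        |(u s - Real.exp s) - (u t - Real.exp t)| ≤ δ * |s - t| := by
  have hd : Differentiable ℝ σ := hσ.differentiable (by norm_num)
  set V := Submodule.span ℝ (Set.range fun q : ℝ × ℝ => fun t : ℝ => σ (q.1 * t + q.2)) with hV
  let τ : C(ℝ, ℝ) := ⟨deriv σ, hσ.continuous_deriv (le_refl _)⟩
  have hdense := topologicalClosure_span_affineComp_eq_top (τ := τ)
    (not_exists_polynomial_deriv hd hp) R
  set S := Submodule.span ℝ {g : C(Set.Icc (-R) R, ℝ) | ∃ a b : ℝ, a ≠ 0 ∧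
      g = affineComp τ ⟨Subtype.val, continuous_subtype_val⟩ a b} with hS
  have hprim : ∀ g ∈ S, ∃ u ∈ V, ∀ t : Set.Icc (-R) R, HasDerivAt u (g t) t := by
    intro g hg
    induction hg using Submodule.span_induction with
    | mem g hg =>
      obtain ⟨a, b, ha, rfl⟩ := hg
      refine ⟨a⁻¹ • fun t => σ (a * t + b), V.smul_mem _ (Submodule.subset_span ⟨(a, b), rfl⟩),
        fun t => ?_⟩
      have h1 : HasDerivAt (fun t : ℝ => a * t + b) a (t : ℝ) := by
        simpa using ((hasDerivAt_id (t : ℝ)).const_mul a).add_const b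
      have h2 := (((hd (a * t + b)).hasDerivAt).comp (t : ℝ) h1).const_smul a⁻¹
      refine h2.congr_deriv ?_
      simp only [affineComp_apply, ContinuousMap.coe_mk, smul_eq_mul, τ]
      field_simp
    | zero => exact ⟨0, V.zero_mem, fun t => hasDerivAt_const _ _⟩
    | add g g' _ _ ih ih' =>
      obtain ⟨u, hu, h⟩ := ih
      obtain ⟨u', hu', h'⟩ := ih'
      exact ⟨u + u', V.add_mem hu hu', fun t => (h t).add (h' t)⟩
    | smul c g _ ih =>
      obtain ⟨u, hu, h⟩ := ih
      exact ⟨c • u, V.smul_mem c hu, fun t => (h t).const_smul c⟩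
  let e : C(Set.Icc (-R) R, ℝ) := ⟨fun t => Real.exp t, by fun_prop⟩
  have he : e ∈ closure (S : Set C(Set.Icc (-R) R, ℝ)) := by
    rw [← Submodule.topologicalClosure_coe, hdense]; trivial
  -- The derivative bound is integrated over a distance of at most `R` from `0`, so the error stays
  -- below `δ`.
  have hη : 0 < δ / (R + 1) := by positivity
  obtain ⟨g, hg, hge⟩ := Metric.mem_closure_iff.1 he _ hη
  obtain ⟨u, hu, hud⟩ := hprim g hg
  have hlip : ∀ s ∈ Set.Icc (-R) R, ∀ t ∈ Set.Icc (-R) R,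
        |(u s - Real.exp s) - (u t - Real.exp t)| ≤ δ / (R + 1) * |s - t| := by
    intro s hs t ht
    have := (convex_Icc (-R) R).norm_image_sub_le_of_norm_hasDerivWithin_le
      (f := fun t => u t - Real.exp t) (f' := fun t => deriv u t - Real.exp t) (C := δ / (R + 1))
      (fun x hx => (((hud ⟨x, hx⟩).differentiableAt.hasDerivAt).sub
        (Real.hasDerivAt_exp x)).hasDerivWithinAt)
      (fun x hx => by
        rw [(hud ⟨x, hx⟩).deriv]
        have h1 := (ContinuousMap.dist_apply_le_dist (f := e) (g := g) ⟨x, hx⟩).trans hge.le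
        rw [dist_comm, Real.dist_eq] at h1
        exact h1) ht hs
    simpa [Real.norm_eq_abs] using this
  -- A nonzero value of `σ` puts the constants into `V` (take `a = 0`), so the primitive can be
  -- corrected to agree with `exp` at `0`.
  obtain ⟨b, hb⟩ : ∃ b, σ b ≠ 0 := by
    by_contra! hcon
    exact hp ⟨0, fun t => by rw [hcon t, Polynomial.eval_zero]⟩
  have hle : δ / (R + 1) ≤ δ := div_le_self hδ.le (by linarith)
  have hw : ∀ t, (u + ((1 - u 0) / σ b) • fun t => σ (0 * t + b)) t - Real.exp t =
      (u t - Real.exp t) - (u 0 - Real.exp 0) := by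
    intro t
    simp only [Pi.add_apply, Pi.smul_apply, zero_mul, zero_add, smul_eq_mul, Real.exp_zero]
    field_simp
    ring
  refine ⟨u + ((1 - u 0) / σ b) • fun t => σ (0 * t + b),
    V.add_mem hu (V.smul_mem _ (Submodule.subset_span ⟨(0, b), rfl⟩)), fun t ht => ?_,
    fun s hs t ht => ?_⟩
  · rw [hw]
    refine (hlip t ht 0 ⟨by linarith, hR⟩).trans ?_
    rw [sub_zero, div_mul_eq_mul_div, div_le_iff₀ (by linarith)]
    have := abs_le.2 ht
    nlinarith
  · rw [hw, hw, sub_sub_sub_cancel_right]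
    exact (hlip s hs t ht).trans (mul_le_mul_of_nonneg_right hle (abs_nonneg _))

end DerivativeDensity

/-! ### From exponential sums to ridge sums in several variables -/

section LipschitzApproximation

variable {E : Type*} [NormedAddCommGroup E]

/-- `u - g` is bounded by `δ` and `δ`-Lipschitz on `B`. -/
def LipClose (B : Set E) (δ : ℝ) (u g : E → ℝ) : Prop :=
  (∀ x ∈ B, |u x - g x| ≤ δ) ∧ ∀ x ∈ B, ∀ y ∈ B, |(u x - g x) - (u y - g y)| ≤ δ * ‖x - y‖

theorem LipClose.mono {B : Set E} {δ δ' : ℝ} {u g : E → ℝ} (h : LipClose B δ u g) (hδ : δ ≤ δ') :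
    LipClose B δ' u g :=
  ⟨fun x hx => (h.1 x hx).trans hδ, fun x hx y hy => (h.2 x hx y hy).trans
    (mul_le_mul_of_nonneg_right hδ (norm_nonneg _))⟩

theorem LipClose.add {B : Set E} {δ δ' : ℝ} {u g u' g' : E → ℝ} (h : LipClose B δ u g)
    (h' : LipClose B δ' u' g') : LipClose B (δ + δ') (u + u') (g + g') := by
  refine ⟨fun x hx => ?_, fun x hx y hy => ?_⟩
  · refine le_trans (le_of_eq ?_) ((abs_add_le _ _).trans (add_le_add (h.1 x hx) (h'.1 x hx)))
    simp only [Pi.add_apply]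
    congr 1; ring
  · rw [add_mul]
    refine le_trans (le_of_eq ?_) ((abs_add_le _ _).trans
      (add_le_add (h.2 x hx y hy) (h'.2 x hx y hy)))
    simp only [Pi.add_apply]
    congr 1; ring

theorem LipClose.trans {B : Set E} {δ δ' : ℝ} {u g g' : E → ℝ} (h : LipClose B δ u g)
    (h' : LipClose B δ' g g') : LipClose B (δ + δ') u g' := by
  refine ⟨fun x hx => ?_, fun x hx y hy => ?_⟩
  · refine le_trans (le_of_eq ?_) ((abs_add_le _ _).trans (add_le_add (h.1 x hx) (h'.1 x hx)))
    congr 1; ring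
  · rw [add_mul]
    refine le_trans (le_of_eq ?_) ((abs_add_le _ _).trans
      (add_le_add (h.2 x hx y hy) (h'.2 x hx y hy)))
    congr 1; ring

theorem LipClose.smul {B : Set E} {δ : ℝ} {u g : E → ℝ} (h : LipClose B δ u g) (c : ℝ) :
    LipClose B (|c| * δ) (c • u) (c • g) := by
  refine ⟨fun x hx => ?_, fun x hx y hy => ?_⟩
  · simp only [Pi.smul_apply, smul_eq_mul, ← mul_sub, abs_mul]
    exact mul_le_mul_of_nonneg_left (h.1 x hx) (abs_nonneg c)
  · simp only [Pi.smul_apply, smul_eq_mul, ← mul_sub, abs_mul, mul_assoc]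
    exact mul_le_mul_of_nonneg_left (h.2 x hx y hy) (abs_nonneg c)

variable [NormedSpace ℝ E]

/-- Finite linear combinations of the ridge functions `x ↦ σ (ℓ x + b)`. -/
def ridgeSpan (E : Type*) [NormedAddCommGroup E] [NormedSpace ℝ E] (σ : ℝ → ℝ) :
    Submodule ℝ (E → ℝ) :=
  Submodule.span ℝ (Set.range fun q : (E →L[ℝ] ℝ) × ℝ => fun x => σ (q.1 x + q.2))

/-- The exponential of a continuous linear functional. -/
noncomputable def expRidge (ℓ : E →L[ℝ] ℝ) : C(E, ℝ) := ⟨fun x => Real.exp (ℓ x), by fun_prop⟩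

@[simp] theorem expRidge_apply (ℓ : E →L[ℝ] ℝ) (x : E) : expRidge ℓ x = Real.exp (ℓ x) := rfl

/-- Finite linear combinations of exponentials of continuous linear functionals. -/
noncomputable def expSpan (E : Type*) [NormedAddCommGroup E] [NormedSpace ℝ E] :
    Submodule ℝ C(E, ℝ) :=
  Submodule.span ℝ (Set.range expRidge)

/-- Stone–Weierstrass: products of these exponentials are again such exponentials, so their span is
an algebra, and it separates points because linear functionals do. -/
theorem exists_mem_expSpan_near {f : E → ℝ} (hf : Continuous f) {K : Set E} (hK : IsCompact K)
    {ε : ℝ} (hε : 0 < ε) : ∃ g ∈ expSpan E, ∀ x ∈ K, |g x - f x| < ε := by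
  let M : Submonoid C(E, ℝ) :=
    { carrier := Set.range expRidge
      one_mem' := ⟨0, by ext; simp⟩
      mul_mem' := by
        rintro _ _ ⟨ℓ, rfl⟩ ⟨ℓ', rfl⟩
        exact ⟨ℓ + ℓ', by ext; simp [Real.exp_add]⟩ }
  have hA : Subalgebra.toSubmodule (Algebra.adjoin ℝ (Set.range (expRidge (E := E)))) =
      expSpan E := by
    rw [Algebra.adjoin_eq_span]
    congr 1
    exact congrArg _ (Submonoid.closure_eq M)
  have hsep : (Algebra.adjoin ℝ (Set.range (expRidge (E := E)))).SeparatesPoints := by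
    intro x y hxy
    obtain ⟨ℓ, hℓ⟩ := SeparatingDual.exists_separating_of_ne (R := ℝ) hxy
    refine ⟨_, ⟨expRidge ℓ, Algebra.subset_adjoin ⟨ℓ, rfl⟩, rfl⟩, fun h => hℓ ?_⟩
    exact Real.exp_injective h
  obtain ⟨g, hg, h⟩ :=
    ContinuousMap.exists_mem_subalgebra_near_continuous_of_isCompact_of_separatesPoints
      hsep ⟨f, hf⟩ hK hε
  exact ⟨g, hA ▸ hg, h⟩

/-- Exponential sums are approximated by ridge sums in the Lipschitz sense on bounded sets. -/
theorem exists_mem_ridgeSpan_lipClose {σ : ℝ → ℝ} (hσ : ContDiff ℝ 1 σ)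
    (hp : ¬ ∃ p : Polynomial ℝ, ∀ t : ℝ, σ t = p.eval t) {R : ℝ} (hR : 0 ≤ R)
    {g : C(E, ℝ)} (hg : g ∈ expSpan E) {δ : ℝ} (hδ : 0 < δ) :
    ∃ u ∈ ridgeSpan E σ, LipClose (Metric.closedBall (0 : E) R) δ u g := by
  induction hg using Submodule.span_induction generalizing δ with
  | mem g hg =>
    obtain ⟨ℓ, rfl⟩ := hg
    have hη : 0 < δ / (‖ℓ‖ + 1) := by positivity
    have hηδ : δ / (‖ℓ‖ + 1) ≤ δ := div_le_self hδ.le (by linarith [norm_nonneg ℓ])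
    obtain ⟨u, hu, h1, h2⟩ := exists_mem_span_approx_exp hσ hp
      (mul_nonneg (norm_nonneg ℓ) hR) hη
    have hmem : ∀ x ∈ Metric.closedBall (0 : E) R, ℓ x ∈ Set.Icc (-(‖ℓ‖ * R)) (‖ℓ‖ * R) := by
      intro x hx
      rw [mem_closedBall_zero_iff] at hx
      exact abs_le.1 ((ℓ.le_opNorm x).trans (mul_le_mul_of_nonneg_left hx (norm_nonneg _)))
    refine ⟨u ∘ ℓ, ?_, fun x hx => (h1 _ (hmem x hx)).trans hηδ, fun x hx y hy => ?_⟩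
    · clear h1 h2
      induction hu using Submodule.span_induction with
      | mem u hu =>
        obtain ⟨⟨a, b⟩, rfl⟩ := hu
        exact Submodule.subset_span ⟨(a • ℓ, b), rfl⟩
      | zero => exact (ridgeSpan E σ).zero_mem
      | add u v _ _ ih ih' => exact (ridgeSpan E σ).add_mem ih ih'
      | smul c u _ ih => exact (ridgeSpan E σ).smul_mem c ih
    · refine (h2 _ (hmem x hx) _ (hmem y hy)).trans ?_
      rw [← map_sub, div_mul_eq_mul_div, div_le_iff₀ (by positivity), mul_assoc]
      refine mul_le_mul_of_nonneg_left ?_ hδ.le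
      have := ℓ.le_opNorm (x - y)
      rw [Real.norm_eq_abs] at this
      nlinarith [norm_nonneg (x - y)]
  | zero =>
    refine ⟨0, (ridgeSpan E σ).zero_mem, fun x _ => by simpa using hδ.le, fun x _ y _ => ?_⟩
    simpa using mul_nonneg hδ.le (norm_nonneg _)
  | add g g' _ _ ih ih' =>
    obtain ⟨u, hu, h⟩ := ih (half_pos hδ)
    obtain ⟨u', hu', h'⟩ := ih' (half_pos hδ)
    exact ⟨u + u', (ridgeSpan E σ).add_mem hu hu', by simpa using h.add h'⟩
  | smul c g _ ih =>
    obtain ⟨u, hu, h⟩ := ih (δ := δ / (|c| + 1)) (by positivity)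
    refine ⟨c • u, (ridgeSpan E σ).smul_mem c hu, (h.smul c).mono ?_⟩
    rw [mul_div_assoc', div_le_iff₀ (by positivity)]
    nlinarith [abs_nonneg c]

end LipschitzApproximation

/-! ### Convolution with a compactly supported Lipschitz kernel -/

section Mollification

open MeasureTheory

variable {E : Type*} [NormedAddCommGroup E] [MeasurableSpace E] [BorelSpace E]
  {μ : Measure E} [μ.IsAddHaarMeasure] {k : E → ℝ}

theorem integrable_kernel_mul (hk : Continuous k) (hks : HasCompactSupport k) {f : E → ℝ}
    (hf : Continuous f) (x : E) : Integrable (fun y => k y * f (x - y)) μ :=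
  (hk.mul (hf.comp (continuous_const.sub continuous_id))).integrable_of_hasCompactSupport
    hks.mul_right

/-- A weighted mean of a function bounded by `c` on the support of the weight is bounded by `c`. -/
theorem abs_integral_kernel_mul_le (hk : Continuous k) (hks : HasCompactSupport k)
    (hk0 : ∀ y, 0 ≤ k y) (hk1 : ∫ y, k y ∂μ = 1) {v : E → ℝ} {c : ℝ}
    (hv : ∀ y, k y ≠ 0 → |v y| ≤ c) : |∫ y, k y * v y ∂μ| ≤ c := by
  have hint : Integrable (fun y => k y * c) μ :=
    (hk.integrable_of_hasCompactSupport hks).mul_const c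
  have := norm_integral_le_of_norm_le (f := fun y => k y * v y) hint
    (Filter.Eventually.of_forall fun y => by
      rw [Real.norm_eq_abs, abs_mul, abs_of_nonneg (hk0 y)]
      by_cases h : k y = 0
      · simp [h]
      · exact mul_le_mul_of_nonneg_left (hv y h) (hk0 y))
  rwa [integral_mul_const, hk1, one_mul] at this

theorem integral_kernel_mul_sub (hk : Continuous k) (hks : HasCompactSupport k)
    {f g : E → ℝ} (hf : Continuous f) (hg : Continuous g) (x x' : E) :
    (∫ y, k y * f (x - y) ∂μ) - ∫ y, k y * g (x' - y) ∂μ =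
      ∫ y, k y * (f (x - y) - g (x' - y)) ∂μ := by
  rw [← integral_sub (integrable_kernel_mul hk hks hf x) (integrable_kernel_mul hk hks hg x')]
  simp only [mul_sub]

variable [NormedSpace ℝ E]

/-- Exponentials are eigenfunctions of convolution: `exp ∘ ℓ` is multiplied by the scalar `∫ k y *
exp (-ℓ y)`. -/
theorem exists_mem_expSpan_mollify (hk : Continuous k) (hks : HasCompactSupport k)
    {g : C(E, ℝ)} (hg : g ∈ expSpan E) :
    ∃ g' ∈ expSpan E, ∀ x, g' x = ∫ y, k y * g (x - y) ∂μ := by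
  induction hg using Submodule.span_induction with
  | mem g hg =>
    obtain ⟨ℓ, rfl⟩ := hg
    refine ⟨(∫ y, k y * Real.exp (-ℓ y) ∂μ) • expRidge ℓ,
      (expSpan E).smul_mem _ (Submodule.subset_span ⟨ℓ, rfl⟩), fun x => ?_⟩
    rw [ContinuousMap.smul_apply, smul_eq_mul, ← integral_mul_const]
    refine integral_congr_ae (Filter.Eventually.of_forall fun y => ?_)
    simp only [expRidge_apply]
    rw [map_sub, sub_eq_neg_add, Real.exp_add]
    ring
  | zero => exact ⟨0, (expSpan E).zero_mem, fun x => by simp⟩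
  | add u v _ _ ih ih' =>
    obtain ⟨u', hu, h⟩ := ih
    obtain ⟨v', hv, h'⟩ := ih'
    refine ⟨u' + v', (expSpan E).add_mem hu hv, fun x => ?_⟩
    rw [ContinuousMap.add_apply, h, h', ← integral_add (integrable_kernel_mul hk hks u.continuous x)
      (integrable_kernel_mul hk hks v.continuous x)]
    simp only [ContinuousMap.add_apply, mul_add]
  | smul c u _ ih =>
    obtain ⟨u', hu, h⟩ := ih
    refine ⟨c • u', (expSpan E).smul_mem c hu, fun x => ?_⟩
    rw [ContinuousMap.smul_apply, h, smul_eq_mul, ← integral_const_mul]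
    refine integral_congr_ae (Filter.Eventually.of_forall fun y => ?_)
    simp only [ContinuousMap.smul_apply, smul_eq_mul]
    ring

variable [FiniteDimensional ℝ E]

/-- There are nonnegative Lipschitz mollifiers of integral one and arbitrarily small support. -/
theorem exists_lipschitz_mollifier (ν : Measure E) [ν.IsAddHaarMeasure] {r : ℝ} (hr : 0 < r) :
    ∃ k : E → ℝ, ∃ M : NNReal, LipschitzWith M k ∧ HasCompactSupport k ∧ (∀ y, 0 ≤ k y) ∧
      ∫ y, k y ∂ν = 1 ∧ ∀ y, r < ‖y‖ → k y = 0 := by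
  let φ : ContDiffBump (0 : E) := ⟨r / 2, r, half_pos hr, half_lt_self hr⟩
  obtain ⟨M, hM⟩ := ContDiff.lipschitzWith_of_hasCompactSupport (𝕂 := ℝ)
    (φ.hasCompactSupport_normed (μ := ν)) (φ.contDiff_normed (n := 1)) (by simp)
  refine ⟨φ.normed ν, M, hM, φ.hasCompactSupport_normed, φ.nonneg_normed, φ.integral_normed,
    fun y hy => ?_⟩
  have h : y ∉ Function.support (φ.normed ν) := by
    rw [φ.support_normed_eq, mem_ball_zero_iff]
    exact not_lt.2 hy.le
  exact Function.notMem_support.1 h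

/-- Mollification turns uniform closeness into closeness in the Lipschitz sense. -/
theorem lipClose_mollify {M : NNReal} (hk : LipschitzWith M k) (hks : HasCompactSupport k)
    (hk0 : ∀ y, 0 ≤ k y) (hk1 : ∫ y, k y ∂μ = 1) {r R η : ℝ} (hkr : ∀ y, r < ‖y‖ → k y = 0)
    {f g : E → ℝ} (hf : Continuous f) (hg : Continuous g)
    (hfg : ∀ x ∈ Metric.closedBall (0 : E) (R + r), |f x - g x| ≤ η) :
    LipClose (Metric.closedBall (0 : E) R)
      (max η (M * η * μ.real (Metric.closedBall (0 : E) (R + r))))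
      (fun x => ∫ y, k y * f (x - y) ∂μ) (fun x => ∫ y, k y * g (x - y) ∂μ) := by
  have hkc := hk.continuous
  refine ⟨fun x hx => ?_, fun x hx x' hx' => ?_⟩
  · rw [integral_kernel_mul_sub hkc hks hf hg]
    refine (abs_integral_kernel_mul_le hkc hks hk0 hk1 fun y hy => hfg _ ?_).trans (le_max_left _ _)
    rw [mem_closedBall_zero_iff] at hx ⊢
    exact (norm_sub_le _ _).trans (add_le_add hx (not_lt.1 fun h => hy (hkr y h)))
  · rw [integral_kernel_mul_sub hkc hks hf hg, integral_kernel_mul_sub hkc hks hf hg]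
    have hd : Continuous fun y => f y - g y := hf.sub hg
    -- The substitution moves `z` into the kernel, so the Lipschitz bound of `k` is combined with
    -- only a uniform bound on `f - g`.
    have hcv : ∀ z, ∫ y, k y * (f (z - y) - g (z - y)) ∂μ = ∫ y, k (z - y) * (f y - g y) ∂μ := by
      intro z
      rw [← integral_sub_left_eq_self _ μ z]
      simp only [sub_sub_cancel]
    have hint : ∀ z, Integrable (fun y => k (z - y) * (f y - g y)) μ := by
      intro z
      have := (integrable_kernel_mul (μ := μ) hkc hks hd z).comp_sub_left z
      simpa only [sub_sub_cancel] using this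
    rw [hcv, hcv, ← integral_sub (hint x) (hint x')]
    have hsupp : ∀ z ∈ Metric.closedBall (0 : E) R, ∀ y ∉ Metric.closedBall (0 : E) (R + r),
        k (z - y) = 0 := by
      intro z hz y hy
      rw [mem_closedBall_zero_iff] at hz hy
      refine hkr _ ?_
      have := norm_sub_norm_le y z
      rw [norm_sub_rev] at this
      linarith [not_le.1 hy]
    rw [← setIntegral_eq_integral_of_forall_compl_eq_zero
      (s := Metric.closedBall (0 : E) (R + r)) fun y hy => by
        rw [hsupp x hx y hy, hsupp x' hx' y hy]; simp]
    refine (norm_setIntegral_le_of_norm_le_const (μ := μ) (s := Metric.closedBall (0 : E) (R + r))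
      (f := fun y => k (x - y) * (f y - g y) - k (x' - y) * (f y - g y)) (C := M * ‖x - x'‖ * η)
      (isCompact_closedBall (0 : E) (R + r)).measure_lt_top fun y hy => ?_).trans ?_
    · rw [← sub_mul, norm_mul]
      refine mul_le_mul ?_ (hfg y hy) (norm_nonneg _) (by positivity)
      have := hk.norm_sub_le (x - y) (x' - y)
      rwa [sub_sub_sub_cancel_right] at this
    · calc (M : ℝ) * ‖x - x'‖ * η * μ.real (Metric.closedBall (0 : E) (R + r))
          = (M * η * μ.real (Metric.closedBall (0 : E) (R + r))) * ‖x - x'‖ := by ring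
        _ ≤ _ := mul_le_mul_of_nonneg_right (le_max_right _ _) (norm_nonneg _)

end Mollification

/-! ### Scalar approximation with almost the same Lipschitz constant -/

section RidgeApproximation

open MeasureTheory

variable {E : Type*} [NormedAddCommGroup E] [NormedSpace ℝ E] [FiniteDimensional ℝ E]

/-- Lipschitz functions on a finite-dimensional space are approximated on compact sets by ridge
sums with almost the same Lipschitz constant. -/
theorem exists_mem_ridgeSpan_approx {σ : ℝ → ℝ} (hσ : ContDiff ℝ 1 σ)
    (hp : ¬ ∃ p : Polynomial ℝ, ∀ t : ℝ, σ t = p.eval t) {K : Set E} (hK : IsCompact K)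
    {L : NNReal} {f : E → ℝ} (hf : LipschitzWith L f) {δ : ℝ} (hδ : 0 < δ) :
    ∃ u ∈ ridgeSpan E σ, (∀ x ∈ K, |u x - f x| ≤ δ) ∧
      ∀ x ∈ K, ∀ y ∈ K, |u x - u y| ≤ (L + δ) * ‖x - y‖ := by
  borelize E
  let μ : Measure E := Measure.addHaar
  obtain ⟨R, hR, hKR⟩ : ∃ R : ℝ, 0 ≤ R ∧ K ⊆ Metric.closedBall 0 R := by
    obtain ⟨R, hR⟩ := hK.isBounded.subset_closedBall 0
    exact ⟨max R 0, le_max_right _ _, hR.trans (Metric.closedBall_subset_closedBall (le_max_left _ _))⟩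
  have hr : 0 < δ / (2 * (L + 1)) := by positivity
  -- Averaging over shifts of length at most `r` moves `f` by at most `L * r ≤ δ / 2`.
  set r := δ / (2 * (L + 1)) with hrdef
  have hLr : L * r ≤ δ / 2 := by
    rw [hrdef, mul_div_assoc', div_le_div_iff₀ (by positivity) two_pos]
    nlinarith [L.2]
  obtain ⟨k, M, hk, hks, hk0, hk1, hkr⟩ := exists_lipschitz_mollifier μ hr
  have hkc := hk.continuous
  set V := μ.real (Metric.closedBall (0 : E) (R + r)) with hV
  have hV0 : 0 ≤ V := measureReal_nonneg
  have hη : 0 < δ / (4 * (M * V + 1)) := by positivity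
  -- The kernel, hence `M` and `V`, is fixed before the uniform accuracy `η`, which can therefore
  -- offset a large `M`.
  set η := δ / (4 * (M * V + 1)) with hηdef
  have hη1 : max η (M * η * V) ≤ δ / 4 := by
    have h1 : (M * V + 1) * η = δ / 4 := by rw [hηdef]; field_simp
    have h2 : 0 ≤ M * V * η := by positivity
    exact max_le (by linarith) (by linarith)
  obtain ⟨g, hg, hgf⟩ := exists_mem_expSpan_near hf.continuous
    (isCompact_closedBall (0 : E) (R + r)) hη
  have h1 := lipClose_mollify (μ := μ) hk hks hk0 hk1 hkr g.continuous hf.continuous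
    fun x hx => (hgf x hx).le
  obtain ⟨g', hg', hgg⟩ := exists_mem_expSpan_mollify (μ := μ) hkc hks hg
  obtain ⟨u, hu, h2⟩ := exists_mem_ridgeSpan_lipClose hσ hp hR hg' (δ := δ / 4) (by positivity)
  rw [funext hgg] at h2
  have h3 := (h2.trans (h1.mono hη1)).mono (by linarith : δ / 4 + δ / 4 ≤ δ / 2)
  have hlip : ∀ x y, |(∫ z, k z * f (x - z) ∂μ) - ∫ z, k z * f (y - z) ∂μ| ≤ L * ‖x - y‖ := by
    intro x y
    rw [integral_kernel_mul_sub hkc hks hf.continuous hf.continuous]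
    refine abs_integral_kernel_mul_le hkc hks hk0 hk1 fun z _ => ?_
    have := hf.norm_sub_le (x - z) (y - z)
    rwa [sub_sub_sub_cancel_right] at this
  have hclose : ∀ x, |(∫ z, k z * f (x - z) ∂μ) - f x| ≤ δ / 2 := by
    intro x
    have h4 : f x = ∫ z, k z * f x ∂μ := by rw [integral_mul_const, hk1, one_mul]
    rw [h4, ← integral_sub (integrable_kernel_mul hkc hks hf.continuous x)
      ((hkc.integrable_of_hasCompactSupport hks).mul_const _)]
    simp only [← mul_sub]
    refine abs_integral_kernel_mul_le hkc hks hk0 hk1 fun z hz => ?_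
    have h5 := hf.norm_sub_le (x - z) x
    rw [sub_sub_cancel_left, norm_neg] at h5
    exact h5.trans ((mul_le_mul_of_nonneg_left (not_lt.1 fun h => hz (hkr z h)) L.2).trans hLr)
  refine ⟨u, hu, fun x hx => ?_, fun x hx y hy => ?_⟩
  · have := (abs_sub_le (u x) (∫ z, k z * f (x - z) ∂μ) (f x)).trans
      (add_le_add (h3.1 x (hKR hx)) (hclose x))
    linarith
  · have h6 := h3.2 x (hKR hx) y (hKR hy)
    have h7 := hlip x y
    have h8 := norm_nonneg (x - y)
    rw [abs_le] at h6 h7 ⊢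
    constructor <;> nlinarith

end RidgeApproximation

/-! ### Assembly of networks and transport of norms -/

section Networks

/-- Finitely many ridge sums are the outputs of one network with a hidden layer. -/
theorem exists_shallowNet_eq {n m : ℕ} {σ : ℝ → ℝ} {u : Fin m → (Fin n → ℝ) → ℝ}
    (hu : ∀ i, u i ∈ ridgeSpan (Fin n → ℝ) σ) :
    ∃ (k : ℕ) (A : Matrix (Fin k) (Fin n) ℝ) (b : Fin k → ℝ) (C : Matrix (Fin m) (Fin k) ℝ),
      ∀ x i, shallowNet σ A b C x i = u i x := by
  have h1 : ∀ i, ∃ (k : ℕ) (c : Fin k → ℝ) (ℓ : Fin k → (Fin n → ℝ) →L[ℝ] ℝ) (b : Fin k → ℝ),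
      ∀ x, u i x = ∑ j, c j * σ (ℓ j x + b j) := by
    intro i
    obtain ⟨k, c, g, hg⟩ := Submodule.mem_span_set'.1 (hu i)
    choose q hq using fun j => (g j).2
    refine ⟨k, c, fun j => (q j).1, fun j => (q j).2, fun x => ?_⟩
    rw [← hg, Finset.sum_apply]
    refine Finset.sum_congr rfl fun j _ => ?_
    rw [Pi.smul_apply, ← hq j, smul_eq_mul]
  choose k c ℓ b h using h1
  -- The hidden layer is the disjoint union of the units of all coordinates; row `i` of `C` is
  -- supported on block `i`.
  let e := finSigmaFinEquiv (n := k)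
  refine ⟨∑ i, k i, fun j l => ℓ (e.symm j).1 (e.symm j).2 (Pi.single l 1),
    fun j => b (e.symm j).1 (e.symm j).2,
    fun i j => if (e.symm j).1 = i then c (e.symm j).1 (e.symm j).2 else 0, fun x i => ?_⟩
  have hA : ∀ i j, ∑ l, ℓ i j (Pi.single l 1) * x l = ℓ i j x := by
    intro i j
    conv_rhs => rw [pi_eq_sum_univ' x, map_sum]
    refine Finset.sum_congr rfl fun l _ => ?_
    rw [map_smul, smul_eq_mul, mul_comm]
  rw [h]
  simp only [shallowNet, Matrix.mulVec, dotProduct]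
  rw [← e.sum_comp]
  simp only [Function.comp_apply, Pi.add_apply, Matrix.mulVec, dotProduct, Equiv.symm_apply_apply,
    hA]
  rw [Fintype.sum_sigma, Finset.sum_eq_single i]
  · simp only [if_true]
    refine Finset.sum_congr rfl fun j _ => ?_
    exact congrArg (fun p : (i : Fin m) × Fin (k i) => c p.1 p.2 * σ (ℓ p.1 p.2 x + b p.1 p.2))
      (e.symm_apply_apply ⟨i, j⟩)
  · intro i' _ hi
    simp [hi]
  · simp

theorem comp_mem_ridgeSpan {E F : Type*} [NormedAddCommGroup E] [NormedSpace ℝ E]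
    [NormedAddCommGroup F] [NormedSpace ℝ F] {σ : ℝ → ℝ} {u : E → ℝ} (hu : u ∈ ridgeSpan E σ)
    (T : F →L[ℝ] E) : u ∘ T ∈ ridgeSpan F σ := by
  induction hu using Submodule.span_induction with
  | mem u hu =>
    obtain ⟨⟨ℓ, b⟩, rfl⟩ := hu
    exact Submodule.subset_span ⟨(ℓ.comp T, b), rfl⟩
  | zero => exact (ridgeSpan F σ).zero_mem
  | add u v _ _ ih ih' => exact (ridgeSpan F σ).add_mem ih ih'
  | smul c u _ ih => exact (ridgeSpan F σ).smul_mem c ih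

variable {n m : ℕ} {K : Set (Fin n → ℝ)}

theorem normTwo_le_of_forall_abs_le {v : Fin m → ℝ} {δ : ℝ} (hδ : 0 ≤ δ) (hv : ∀ i, |v i| ≤ δ) :
    normTwo v ≤ (m + 1) * δ := by
  rw [normTwo, EuclideanSpace.norm_eq, Real.sqrt_le_left (by positivity)]
  calc ∑ i, ‖v i‖ ^ 2 ≤ ∑ _i : Fin m, δ ^ 2 :=
        Finset.sum_le_sum fun i _ => pow_le_pow_left₀ (norm_nonneg _) (hv i) 2
    _ = m * δ ^ 2 := by simp
    _ ≤ ((m + 1) * δ) ^ 2 := by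
        rw [mul_pow]
        refine mul_le_mul_of_nonneg_right ?_ (sq_nonneg δ)
        nlinarith [(Nat.cast_nonneg m : (0 : ℝ) ≤ m)]

/-- Approximation by networks with control of the Lipschitz constant, for the norm of a
finite-dimensional space `E` transported to `ℝⁿ`. -/
theorem exists_shallowNet_unifClose_hasLipConst {E : Type*} [NormedAddCommGroup E]
    [NormedSpace ℝ E] [FiniteDimensional ℝ E] (T : (Fin n → ℝ) ≃L[ℝ] E) (hK : IsCompact K)
    {σ : ℝ → ℝ} (hσ : ContDiff ℝ 1 σ) (hp : ¬ ∃ p : Polynomial ℝ, ∀ t : ℝ, σ t = p.eval t)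
    {L : ℝ} (hL : 0 ≤ L) {f : K → Fin m → ℝ} (hf : HasLipConst (fun v => ‖T v‖) f L)
    {L' : ℝ} (hLL : L < L') {ε : ℝ} (hε : 0 < ε) :
    ∃ (k : ℕ) (A : Matrix (Fin k) (Fin n) ℝ) (b : Fin k → ℝ) (C : Matrix (Fin m) (Fin k) ℝ),
      UnifClose f (fun x : K => shallowNet σ A b C x.1) ε ∧
      HasLipConst (fun v => ‖T v‖) (fun x : K => shallowNet σ A b C x.1) L' := by
  have hδ : 0 < min (L' - L) (ε / (2 * (m + 1))) := lt_min (by linarith) (by positivity)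
  -- The first term keeps `L + δ ≤ L'`; the second absorbs the passage from coordinatewise bounds to
  -- the Euclidean norm.
  set δ := min (L' - L) (ε / (2 * (m + 1))) with hδdef
  have hδL : L + δ ≤ L' := by linarith [min_le_left (L' - L) (ε / (2 * ((m : ℝ) + 1)))]
  have hδε : (m + 1) * δ ≤ ε / 2 := by
    have := min_le_right (L' - L) (ε / (2 * ((m : ℝ) + 1)))
    rw [le_div_iff₀ (by positivity)] at this
    linarith
  have hcoord : ∀ i, ∃ u ∈ ridgeSpan (Fin n → ℝ) σ, (∀ x : K, |u x - f x i| ≤ δ) ∧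
      ∀ x y : K, |u x - u y| ≤ (L + δ) * ‖T (x.1 - y.1)‖ := by
    intro i
    let fE : E → ℝ := fun z => Function.extend Subtype.val (fun x : K => f x i) 0 (T.symm z)
    have hfE : ∀ x : K, fE (T x) = f x i := fun x => by
      simp only [fE, ContinuousLinearEquiv.symm_apply_apply]
      exact Subtype.val_injective.extend_apply _ _ x
    have hlip : LipschitzOnWith ⟨L, hL⟩ fE (T '' K) := by
      refine LipschitzOnWith.of_dist_le_mul ?_
      rintro _ ⟨x, hx, rfl⟩ _ ⟨y, hy, rfl⟩
      rw [hfE ⟨x, hx⟩, hfE ⟨y, hy⟩, dist_eq_norm (T x), ← map_sub]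
      exact (norm_le_pi_norm (f ⟨x, hx⟩ - f ⟨y, hy⟩) i).trans (hf ⟨x, hx⟩ ⟨y, hy⟩)
    obtain ⟨F, hF, hFeq⟩ := hlip.extend_real
    obtain ⟨u, hu, h1, h2⟩ := exists_mem_ridgeSpan_approx hσ hp (hK.image T.continuous) hF hδ
    refine ⟨u ∘ T, comp_mem_ridgeSpan hu (T : (Fin n → ℝ) →L[ℝ] E), fun x => ?_, fun x y => ?_⟩
    · have := h1 (T x) (Set.mem_image_of_mem _ x.2)
      rwa [← hFeq (Set.mem_image_of_mem _ x.2), hfE] at this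
    · rw [map_sub]
      exact h2 _ (Set.mem_image_of_mem _ x.2) _ (Set.mem_image_of_mem _ y.2)
  choose u hu h1 h2 using hcoord
  obtain ⟨k, A, b, C, hnet⟩ := exists_shallowNet_eq hu
  have hclose : ∀ x : K, normTwo (f x - shallowNet σ A b C x.1) ≤ ε / 2 := fun x =>
    (normTwo_le_of_forall_abs_le hδ.le fun i => by
      rw [Pi.sub_apply, hnet, abs_sub_comm]
      exact h1 i x).trans hδε
  refine ⟨k, A, b, C, ⟨⟨ε / 2, ?_⟩, ?_⟩, fun x y => ?_⟩
  · rintro _ ⟨x, rfl⟩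
    exact hclose x
  -- The nonnegativity of `ε / 2` covers empty `K`, where the real supremum is `0`.
  · exact (Real.iSup_le hclose (half_pos hε).le).trans_lt (half_lt_self hε)
  · refine (pi_norm_le_iff_of_nonneg (mul_nonneg (by linarith) (norm_nonneg _))).2 fun i => ?_
    simp only [Pi.sub_apply, hnet]
    exact (h2 i x y).trans (mul_le_mul_of_nonneg_right hδL (norm_nonneg _))

/-- The previous approximation result without a sign condition on the Lipschitz constant; on a set
with at most one point every number is a Lipschitz constant. -/
theorem exists_shallowNet_unifClose_hasLipConst' {E : Type*} [NormedAddCommGroup E]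
    [NormedSpace ℝ E] [FiniteDimensional ℝ E] (T : (Fin n → ℝ) ≃L[ℝ] E) (hK : IsCompact K)
    {σ : ℝ → ℝ} (hσ : ContDiff ℝ 1 σ) (hp : ¬ ∃ p : Polynomial ℝ, ∀ t : ℝ, σ t = p.eval t)
    {L : ℝ} {f : K → Fin m → ℝ} (hf : HasLipConst (fun v => ‖T v‖) f L)
    {L' : ℝ} (hLL : 0 < n → 0 ≤ L → L < L') {ε : ℝ} (hε : 0 < ε) :
    ∃ (k : ℕ) (A : Matrix (Fin k) (Fin n) ℝ) (b : Fin k → ℝ) (C : Matrix (Fin m) (Fin k) ℝ),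
      UnifClose f (fun x : K => shallowNet σ A b C x.1) ε ∧
      HasLipConst (fun v => ‖T v‖) (fun x : K => shallowNet σ A b C x.1) L' := by
  by_cases hsub : Subsingleton K
  · have hany : ∀ (g : K → Fin m → ℝ) (c : ℝ), HasLipConst (fun v => ‖T v‖) g c := by
      intro g c x y
      rw [Subsingleton.elim x y]
      simp [normInf]
    obtain ⟨k, A, b, C, h, -⟩ := exists_shallowNet_unifClose_hasLipConst T hK hσ hp le_rfl
      (hany f 0) one_pos hε
    exact ⟨k, A, b, C, h, hany _ _⟩
  · obtain ⟨x, y, hxy⟩ := not_subsingleton_iff_nontrivial.1 hsub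
    have hne : x.1 - y.1 ≠ 0 := sub_ne_zero.2 fun h => hxy (Subtype.ext h)
    have hpos : 0 < ‖T (x.1 - y.1)‖ := norm_pos_iff.2 fun h => hne (T.map_eq_zero_iff.1 h)
    have hL : 0 ≤ L := nonneg_of_mul_nonneg_left ((norm_nonneg _).trans (hf x y)) hpos
    have hn : 0 < n := by
      rcases Nat.eq_zero_or_pos n with rfl | h
      · exact absurd (Subsingleton.elim _ _) hne
      · exact h
    exact exists_shallowNet_unifClose_hasLipConst T hK hσ hp hL hf (hLL hn hL) hε

end Networks

theorem mainTheorem2 {n m : ℕ} (K : Set (Fin n → ℝ)) (hK : IsCompact K)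
    (σ : ℝ → ℝ) (hσ : ContDiff ℝ 1 σ)
    (hσ_poly : ¬ ∃ p : Polynomial ℝ, ∀ t : ℝ, σ t = p.eval t) :
    (∀ (L : ℝ) (f : K → Fin m → ℝ), HasLipConst normInf f L →
      ∀ ε : ℝ, 0 < ε →
        ∃ (k : ℕ) (A : Matrix (Fin k) (Fin n) ℝ) (b : Fin k → ℝ) (C : Matrix (Fin m) (Fin k) ℝ),
          UnifClose f (fun x : K => shallowNet σ A b C x.1) ε ∧
          HasLipConst normInf (fun x : K => shallowNet σ A b C x.1) (L + ε)) ∧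
    (∀ (L : ℝ) (f : K → Fin m → ℝ), HasLipConst normTwo f L →
      ∀ ε : ℝ, 0 < ε →
        ∃ (k : ℕ) (A : Matrix (Fin k) (Fin n) ℝ) (b : Fin k → ℝ) (C : Matrix (Fin m) (Fin k) ℝ),
          UnifClose f (fun x : K => shallowNet σ A b C x.1) ε ∧
          HasLipConst normTwo (fun x : K => shallowNet σ A b C x.1)
            (L + ε * (Real.sqrt ((n : ℝ) + (n : ℝ) / ε) / 2 + L))) := by
  refine ⟨fun L f hf ε hε => ?_, fun L f hf ε hε => ?_⟩
  · exact exists_shallowNet_unifClose_hasLipConst' (ContinuousLinearEquiv.refl ℝ (Fin n → ℝ)) hK hσ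
      hσ_poly hf (fun _ _ => by linarith) hε
  -- The constant in (b) only has to exceed `L`. The square root makes it do so when `0 < n` and `0
  -- ≤ L`; in every other case `K` has at most one point.
  · refine exists_shallowNet_unifClose_hasLipConst' (EuclideanSpace.equiv (Fin n) ℝ).symm hK hσ
      hσ_poly hf (fun hn hL => ?_) hε
    have hn' : (0 : ℝ) < n := Nat.cast_pos.2 hn
    have hsqrt : 0 < Real.sqrt ((n : ℝ) + (n : ℝ) / ε) := Real.sqrt_pos.2 (by positivity)
    have : 0 < ε * (Real.sqrt ((n : ℝ) + (n : ℝ) / ε) / 2 + L) := by positivity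
    linarith
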